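/- Let $d\ge 0$, let $\mathcal{A}$ be a central arrangement of hyperplanes in $\mathbb{C}^{d+1}$ (a finite set of codimension-one linear subspaces), and let $n=|\mathcal{A}|$. For each $H\in\mathcal{A}$ let $f_H\colon\mathbb{C}^{d+1}\to\mathbb{C}$ be a linear form with kernel $H$, and let $m_H\ge 1$ be an integer. Let $M(\mathcal{A})=\mathbb{C}^{d+1}\setminus\bigcup_{H\in\mathcal{A}}H$ be the complement, let $Q_m(\mathcal{A})=\prod_{H\in\mathcal{A}}f_H^{m_H}$, and let $F_m(\mathcal{A})=\{z\in M(\mathcal{A}) : Q_m(\mathcal{A})(z)=1\}$ be the Milnor fiber of the multi-arrangement $(\mathcal{A},m)$. Suppose $\gcd(m_H : H\in\mathcal{A})=1$ (in particular $\mathcal{A}\neq\emptyset$, since the gcd of the empty family is $0$). Then the first Betti number of the Milnor fiber satisfies $$b_1(F_m(\mathcal{A}))=\operatorname{rank} H_1(F_m(\mathcal{A});\mathbb{Z})\ \ge\ n-1 .$$ Moreover, for every base point $x\in F_m(\mathcal{A})$ there is an epimorphism $\pi_1(F_m(\mathcal{A}),x)\twoheadrightarrow\mathbb{Z}^{n-1}$.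 -/

import Mathlib

/-- A central arrangement of hyperplanes in `ℂ^{d+1}`: a finite set of linear subspaces of
codimension one. -/
structure HyperplaneArrangement (d : ℕ) where
  /-- The hyperplanes of the arrangement. -/
  hyperplanes : Finset (Submodule ℂ (Fin (d + 1) → ℂ))
  /-- Every member has codimension one. -/
  codim_eq_one : ∀ H ∈ hyperplanes, Module.finrank ℂ ((Fin (d + 1) → ℂ) ⧸ H) = 1

namespace HyperplaneArrangement

variable {d : ℕ} (A : HyperplaneArrangement d)

/-- The complement `M(A) = ℂ^{d+1} ∖ ⋃_{H ∈ A} H`. -/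
def complement : Set (Fin (d + 1) → ℂ) :=
  {z | ∀ H ∈ A.hyperplanes, z ∉ H}

/-- A family `f` of linear forms on `ℂ^{d+1}`, indexed by the hyperplanes of `A`, defines `A` if
`f_H` has kernel `H` for every `H ∈ A`. -/
def IsDefiningFamily (f : A.hyperplanes → Module.Dual ℂ (Fin (d + 1) → ℂ)) : Prop :=
  ∀ H : A.hyperplanes, LinearMap.ker (f H) = (H : Submodule ℂ (Fin (d + 1) → ℂ))

/-- The polynomial map `Q_m(A) = ∏_{H ∈ A} f_H ^ {m_H}` on `ℂ^{d+1}`. -/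
noncomputable def definingPolynomial (f : A.hyperplanes → Module.Dual ℂ (Fin (d + 1) → ℂ))
    (m : A.hyperplanes → ℕ) (z : Fin (d + 1) → ℂ) : ℂ :=
  ∏ H : A.hyperplanes, f H z ^ m H

/-- The Milnor fiber `F_m(A)` of the multi-arrangement `(A, m)`: the fiber over `1` of the map
`Q_m(A) : M(A) → ℂ^*`. It carries the topology induced from `ℂ^{d+1}`. -/
def milnorFiber (f : A.hyperplanes → Module.Dual ℂ (Fin (d + 1) → ℂ))
    (m : A.hyperplanes → ℕ) : Set (Fin (d + 1) → ℂ) :=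
  {z | z ∈ A.complement ∧ A.definingPolynomial f m z = 1}

end HyperplaneArrangement

/-- The first singular homology group `H_1(X; ℤ)`. -/
noncomputable abbrev firstHomology (X : Type) [TopologicalSpace X] : ModuleCat.{0} ℤ :=
  ((AlgebraicTopology.singularHomologyFunctor (ModuleCat.{0} ℤ) 1).obj (ModuleCat.of ℤ ℤ)).obj
    (TopCat.of X)

/-- The first Betti number `b_1(X)`, the rank of the abelian group `H_1(X; ℤ)`
(`⊤` if the rank is infinite). -/
noncomputable def firstBettiNumber (X : Type) [TopologicalSpace X] : ℕ∞ :=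
  Cardinal.toENat (Module.rank ℤ (firstHomology X))

/-! Loops in the Milnor fiber are told apart by the winding numbers of the forms `f_H` along them.
For `x` in the complement, move along the circle `x + c(e^{2πit} - 1)v`: there `f_H / f_H(x) = 1 + c
a_H(e^{2πit} - 1)` with `a_H = f_H(v) / f_H(x)`, which winds once around `0` if `Re(c a_H) > 1/2`
and not at all if `Re(c a_H) < 1/2`. For `v` with distinct positive `Re a_H`, varying `c` yields
winding vectors that span `ℤ^n` (`exists_loops_complement`). Put `N = ∑ m_H`, the degree of `Q_m`.
Running a circle `N` times and rescaling the point to keep `Q_m = 1` gives a loop in the fiber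
(`exists_loops_milnorFiber`) with winding vector `N w - ⟨m, w⟩(1, …, 1)`. This map of `w` has kernel
of rank at most one, so the vectors obtained have rank at least `n - 1`. Increments of logarithms
are homomorphisms on both `H_1` and `π_1`, which gives both claims. -/

/-! ### Winding of circles around the origin. -/

theorem Complex.norm_lt_norm_one_sub {b : ℂ} (hb : b.re < 1 / 2) : ‖b‖ < ‖1 - b‖ := by
  rw [← sq_lt_sq₀ (norm_nonneg _) (norm_nonneg _), ← Complex.normSq_eq_norm_sq,
    ← Complex.normSq_eq_norm_sq, Complex.normSq_apply, Complex.normSq_apply]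
  simp only [Complex.sub_re, Complex.one_re, Complex.sub_im, Complex.one_im]
  nlinarith

theorem Complex.one_add_mem_slitPlane_of_norm_lt_one {z : ℂ} (hz : ‖z‖ < 1) :
    1 + z ∈ Complex.slitPlane := by
  refine Or.inl ?_
  have := (abs_le.1 (Complex.abs_re_le_norm z)).1
  simp only [Complex.add_re, Complex.one_re]
  linarith

/-- A continuous logarithm along the circle `t ↦ 1 + b (exp (2πit) - 1)`, normalized to vanish at
`t = 0`, together with its increments along full turns: the circle winds around the origin
once if `1 / 2 < b.re` and does not wind around it if `b.re < 1 / 2`. -/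
theorem exists_log_circle (b : ℂ) (hb : b.re ≠ 1 / 2) :
    ∃ Λ : ℝ → ℂ, Continuous Λ ∧ Λ 0 = 0 ∧
      (∀ t : ℝ, Complex.exp (Λ t) = 1 + b * (Complex.exp (2 * Real.pi * Complex.I * t) - 1)) ∧
      ∀ k : ℕ, Λ k = 2 * Real.pi * Complex.I * (k * ((if 1 / 2 < b.re then 1 else 0 : ℤ) : ℂ)) := by
  have hper (k : ℕ) : Complex.exp (2 * Real.pi * Complex.I * ((k : ℝ) : ℂ)) = 1 := by
    rw [Complex.exp_eq_one_iff]; exact ⟨k, by push_cast; ring⟩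
  have hnorm (t : ℝ) : ‖Complex.exp (2 * Real.pi * Complex.I * t)‖ = 1 := by
    rw [show (2 * Real.pi * Complex.I * t : ℂ) = ((2 * Real.pi * t : ℝ) : ℂ) * Complex.I by
      push_cast; ring]
    exact Complex.norm_exp_ofReal_mul_I _
  have key (q : ℂ) (hq : ‖q‖ < 1) (e : ℂ) (he : ‖e‖ = 1) : 1 + q * e ∈ Complex.slitPlane :=
    Complex.one_add_mem_slitPlane_of_norm_lt_one (by rwa [norm_mul, he, mul_one])
  rcases lt_or_gt_of_ne hb with h | h
  · have h1 := Complex.norm_lt_norm_one_sub h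
    have h2 : 1 - b ≠ 0 := norm_pos_iff.1 ((norm_nonneg b).trans_lt h1)
    -- `1 + b(e - 1) = (1 - b)(1 + q e)` with `|q| < 1`: the second factor stays in the slit plane,
    -- where the principal logarithm is continuous.
    have hq : ‖b / (1 - b)‖ < 1 := by
      rw [norm_div, div_lt_one (norm_pos_iff.2 h2)]; exact h1
    set q := b / (1 - b) with hqdef
    have h0 : 1 + q ∈ Complex.slitPlane := Complex.one_add_mem_slitPlane_of_norm_lt_one hq
    refine ⟨fun t ↦ Complex.log (1 + q * Complex.exp (2 * Real.pi * Complex.I * t)) -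
      Complex.log (1 + q), ?_, ?_, ?_, ?_⟩
    · refine Continuous.sub (Continuous.clog (by fun_prop) fun t ↦ key q hq _ (hnorm t))
        continuous_const
    · simp
    · intro t
      rw [Complex.exp_sub, Complex.exp_log (Complex.slitPlane_ne_zero (key q hq _ (hnorm t))),
        Complex.exp_log (Complex.slitPlane_ne_zero h0)]
      rw [div_eq_iff (Complex.slitPlane_ne_zero h0), hqdef]
      field_simp
      ring
    · intro k
      have := hper k
      rw [if_neg (not_lt.2 h.le)]
      simp only [this]
      simp
  · have h1 : ‖1 - b‖ < ‖b‖ := by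
      have := Complex.norm_lt_norm_one_sub (b := 1 - b)
        (by simp only [Complex.sub_re, Complex.one_re]; linarith)
      simpa using this
    have h2 : b ≠ 0 := norm_pos_iff.1 ((norm_nonneg _).trans_lt h1)
    -- Now `1 + b(e - 1) = b e (1 + q e⁻¹)`; the factor `e` contributes the full turn.
    have hq : ‖(1 - b) / b‖ < 1 := by
      rw [norm_div, div_lt_one (norm_pos_iff.2 h2)]; exact h1
    set q := (1 - b) / b with hqdef
    have h0 : 1 + q ∈ Complex.slitPlane := Complex.one_add_mem_slitPlane_of_norm_lt_one hq
    have hinv (t : ℝ) : ‖(Complex.exp (2 * Real.pi * Complex.I * t))⁻¹‖ = 1 := by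
      rw [norm_inv, hnorm, inv_one]
    refine ⟨fun t ↦ 2 * Real.pi * Complex.I * t +
      Complex.log (1 + q * (Complex.exp (2 * Real.pi * Complex.I * t))⁻¹) -
      Complex.log (1 + q), ?_, ?_, ?_, ?_⟩
    · refine Continuous.sub (Continuous.add (by fun_prop)
        (Continuous.clog ?_ fun t ↦ key q hq _ (hinv t))) continuous_const
      exact continuous_const.add (continuous_const.mul
        (Continuous.inv₀ (by fun_prop) fun t ↦ Complex.exp_ne_zero _))
    · simp
    · intro t
      rw [Complex.exp_sub, Complex.exp_add,
        Complex.exp_log (Complex.slitPlane_ne_zero (key q hq _ (hinv t))),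
        Complex.exp_log (Complex.slitPlane_ne_zero h0)]
      rw [div_eq_iff (Complex.slitPlane_ne_zero h0), hqdef]
      have := Complex.exp_ne_zero (2 * Real.pi * Complex.I * t)
      field_simp
      ring
    · intro k
      have := hper k
      rw [if_pos h]
      simp only [this]
      simp

/-! ### Linear algebra of generic directions and winding vectors. -/

/-- Finitely many pairwise distinct real linear forms take pairwise distinct values at some
vector. -/
theorem exists_injective_apply_of_injective {ι V : Type*} [Finite ι] [AddCommGroup V] [Module ℝ V]
    (ρ : ι → V →ₗ[ℝ] ℝ) (hρ : Function.Injective ρ) :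
    ∃ v, Function.Injective fun i ↦ ρ i v := by
  classical
  have := Fintype.ofFinite ι
  -- A real vector space is not a finite union of proper subspaces, here the kernels of the
  -- differences.
  let s : Finset (Submodule ℝ V) := (Finset.univ : Finset {p : ι × ι // p.1 ≠ p.2}).image
    fun p ↦ LinearMap.ker (ρ p.1.1 - ρ p.1.2)
  have hs : ⊤ ∉ s := by
    simp only [s, Finset.mem_image, Finset.mem_univ, true_and, not_exists]
    intro p hp
    exact p.2 (hρ (sub_eq_zero.1 (LinearMap.ker_eq_top.1 hp)))
  obtain ⟨v, hv⟩ := (Set.ne_univ_iff_exists_notMem _).1 (Subspace.biUnion_ne_univ_of_top_notMem hs)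
  refine ⟨v, fun i j hij ↦ ?_⟩
  by_contra hne
  refine hv (Set.mem_iUnion₂.2 ⟨_, Finset.mem_image.2 ⟨⟨(i, j), hne⟩, Finset.mem_univ _, rfl⟩, ?_⟩)
  simpa [sub_eq_zero] using hij

/-- A finite set of positive real numbers can be cut at any of its members by a threshold of the
form `1 / (2 c)`. -/
theorem exists_threshold {ι : Type*} [Finite ι] (r : ι → ℝ) (hr : ∀ i, 0 < r i) (k : ι) :
    ∃ c : ℝ, ∀ i, c * r i ≠ 1 / 2 ∧ (1 / 2 < c * r i ↔ r k ≤ r i) := by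
  -- Choose `s` just below `r k` and above every smaller value; then `c = 1 / (2 s)`.
  have hfin : ∀ᶠ s in nhdsWithin (r k) (Set.Iio (r k)), 0 < s ∧ ∀ i, r i < r k → r i < s := by
    refine ((eventually_gt_nhds (hr k)).filter_mono nhdsWithin_le_nhds).and ?_
    refine Filter.eventually_all.2 fun i ↦ ?_
    by_cases h : r i < r k
    · filter_upwards [(eventually_gt_nhds h).filter_mono nhdsWithin_le_nhds] with s hs _ using hs
    · exact Filter.Eventually.of_forall fun s h' ↦ absurd h' h
  obtain ⟨s, ⟨hs0, hs⟩, hsk⟩ := (hfin.and self_mem_nhdsWithin).exists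
  have hsk : s < r k := hsk
  refine ⟨1 / (2 * s), fun i ↦ ?_⟩
  have e : 1 / (2 * s) * r i = r i / s / 2 := by field_simp
  rw [e]
  rcases lt_or_ge (r i) (r k) with h | h
  · have h1 : r i / s < 1 := (div_lt_one hs0).2 (hs i h)
    exact ⟨by linarith, ⟨fun h2 ↦ by linarith, fun h2 ↦ absurd h2 (not_le.2 h)⟩⟩
  · have h1 : 1 < r i / s := (one_lt_div hs0).2 (hsk.trans_le h)
    exact ⟨by linarith, ⟨fun _ ↦ h, fun _ ↦ by linarith⟩⟩

/-- The indicator vectors of the upper sets of a linear order, pulled back along an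
injective map, span the integer lattice. -/
theorem span_indicator_le_eq_top {ι : Type*} [Finite ι] (r : ι → ℝ) (hr : Function.Injective r) :
    Submodule.span ℤ (Set.range fun k ↦ fun i ↦ if r k ≤ r i then (1 : ℤ) else 0) = ⊤ := by
  classical
  have := Fintype.ofFinite ι
  set S := Submodule.span ℤ (Set.range fun k ↦ fun i ↦ if r k ≤ r i then (1 : ℤ) else 0)
  -- Induction from the largest value down: a basis vector is its upper-set indicator minus the
  -- basis vectors strictly above.
  have hwf : WellFounded fun i j : ι ↦ r j < r i :=
    Finite.wellFounded_of_trans_of_irrefl _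
  have hsingle (k : ι) : Pi.single k (1 : ℤ) ∈ S := by
    induction k using hwf.induction with
    | _ k ih =>
      have hk : (fun i ↦ if r k ≤ r i then (1 : ℤ) else 0) ∈ S :=
        Submodule.subset_span ⟨k, rfl⟩
      have hsum : (∑ j with r k < r j, Pi.single j (1 : ℤ)) ∈ S :=
        Submodule.sum_mem _ fun j hj ↦ ih j (Finset.mem_filter.1 hj).2
      convert S.sub_mem hk hsum using 1
      ext i
      simp only [Pi.sub_apply, Finset.sum_apply, Pi.single_apply, Finset.sum_ite_eq,
        Finset.mem_filter, Finset.mem_univ, true_and]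
      rcases eq_or_ne i k with rfl | hne
      · simp
      · have := hr.ne hne
        rw [if_neg hne]
        rcases lt_or_gt_of_ne this with h | h
        · rw [if_neg (not_le.2 h), if_neg (not_lt.2 h.le), sub_zero]
        · rw [if_pos h.le, if_pos h, sub_self]
  rw [eq_top_iff]
  intro w _
  have hw : w = ∑ k, w k • Pi.single k (1 : ℤ) := by
    ext i
    simp [Finset.sum_apply, Pi.single_apply]
  rw [hw]
  exact Submodule.sum_mem _ fun k _ ↦ S.smul_mem (w k) (hsingle k)

/-- The linear map `w ↦ N w - ⟨m, w⟩ (1, …, 1)` with `N = ∑ m`. This is the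
winding vector of the lift to the Milnor fiber of the `N`-th power of a loop in the projectivized
complement that is the image of a loop with winding vector `w`. -/
def reducedWinding {ι : Type*} [Fintype ι] (m : ι → ℕ) : (ι → ℤ) →ₗ[ℤ] (ι → ℤ) where
  toFun w := fun i ↦ (∑ j, (m j : ℤ)) * w i - ∑ j, (m j : ℤ) * w j
  map_add' v w := by
    ext i
    simp only [Pi.add_apply, mul_add, Finset.sum_add_distrib]
    ring
  map_smul' a w := by
    ext i
    simp only [Pi.smul_apply, smul_eq_mul, RingHom.id_apply, mul_sub, Finset.mul_sum]
    congr 1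
    · rw [Finset.sum_mul, Finset.sum_mul, Finset.mul_sum]
      exact Finset.sum_congr rfl fun j _ ↦ by ring
    · exact Finset.sum_congr rfl fun j _ ↦ by ring

/-! ### Loops in the complement and in the Milnor fiber. -/

namespace HyperplaneArrangement

variable {d : ℕ} (A : HyperplaneArrangement d)

/-- A complex form is determined by its real part, by evaluating at `I • z`, and proportional forms
have the same kernel. -/
theorem IsDefiningFamily.injective_re {A : HyperplaneArrangement d}
    {f : A.hyperplanes → Module.Dual ℂ (Fin (d + 1) → ℂ)} (hf : A.IsDefiningFamily f)
    (a : A.hyperplanes → ℂ) (ha : ∀ H, a H ≠ 0) :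
    Function.Injective fun H ↦ Complex.reLm ∘ₗ ((a H • f H).restrictScalars ℝ) := by
  intro H K hHK
  have hre (z : Fin (d + 1) → ℂ) : (a H * f H z).re = (a K * f K z).re :=
    congr($hHK z)
  have heq (z : Fin (d + 1) → ℂ) : a H * f H z = a K * f K z := by
    refine Complex.ext (hre z) ?_
    have := hre (Complex.I • z)
    simp only [map_smul, smul_eq_mul, mul_left_comm _ Complex.I, Complex.I_mul_re] at this
    exact neg_injective this
  refine Subtype.ext ?_
  rw [← hf H, ← hf K]
  ext z
  rw [LinearMap.mem_ker, LinearMap.mem_ker]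
  constructor
  · intro h
    simpa [h, ha K] using (heq z).symm
  · intro h
    simpa [h, ha H] using heq z

/-- Loops in the complement whose winding vectors span the integer lattice, with
continuous logarithms defined on the whole real line. -/
theorem exists_loops_complement {f : A.hyperplanes → Module.Dual ℂ (Fin (d + 1) → ℂ)}
    (hf : A.IsDefiningFamily f) (x : Fin (d + 1) → ℂ) (hx : x ∈ A.complement) :
    ∃ w : A.hyperplanes → A.hyperplanes → ℤ, Submodule.span ℤ (Set.range w) = ⊤ ∧
      ∀ K, ∃ (γ : ℝ → Fin (d + 1) → ℂ) (Λ : A.hyperplanes → ℝ → ℂ), Continuous γ ∧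
        γ 0 = x ∧ (∀ k : ℕ, γ k = x) ∧ (∀ H, Continuous (Λ H)) ∧ (∀ H, Λ H 0 = 0) ∧
        (∀ H t, f H (γ t) = f H x * Complex.exp (Λ H t)) ∧
        ∀ H, ∀ k : ℕ, Λ H k = 2 * Real.pi * Complex.I * (k * (w K H : ℂ)) := by
  have hfx (H) : f H x ≠ 0 := fun h ↦ hx H H.2 (by rw [← hf H]; exact h)
  obtain ⟨v₀, hv₀⟩ := exists_injective_apply_of_injective _
    (hf.injective_re (fun H ↦ (f H x)⁻¹) fun H ↦ inv_ne_zero (hfx H))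
  -- Adding `R • x` to `v₀` shifts every ratio `f_H(v₀) / f_H(x)` by `R`: real parts stay distinct
  -- and become positive.
  obtain ⟨R, hR⟩ : ∃ R : ℝ, ∀ H, -((f H x)⁻¹ * f H v₀).re < R := by
    obtain ⟨R, hR⟩ := (Set.finite_range fun H ↦ -((f H x)⁻¹ * f H v₀).re).bddAbove
    exact ⟨R + 1, fun H ↦ (hR ⟨H, rfl⟩).trans_lt (lt_add_one R)⟩
  let v := v₀ + (R : ℂ) • x
  let a (H) : ℂ := (f H x)⁻¹ * f H v
  have hav (H) : f H v = f H x * a H := by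
    simp only [a]; rw [mul_inv_cancel_left₀ (hfx H)]
  have ha (H) : (a H).re = ((f H x)⁻¹ * f H v₀).re + R := by
    simp only [a, v, map_add, map_smul, smul_eq_mul, mul_add, Complex.add_re]
    rw [mul_left_comm, inv_mul_cancel₀ (hfx H), mul_one, Complex.ofReal_re]
  have hinj : Function.Injective fun H ↦ (a H).re := by
    intro H K hHK
    refine hv₀ ?_
    simp only [ha, add_left_inj] at hHK
    exact hHK
  have hpos (H) : 0 < (a H).re := by
    rw [ha]; linarith [hR H]
  refine ⟨_, span_indicator_le_eq_top _ hinj, fun K ↦ ?_⟩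
  obtain ⟨c, hc⟩ := exists_threshold _ hpos K
  have hre (H) : ((c : ℂ) * a H).re = c * (a H).re := Complex.re_ofReal_mul _ _
  choose Λ hΛc hΛ0 hΛe hΛk using fun H ↦
    exists_log_circle ((c : ℂ) * a H) (by rw [hre]; exact (hc H).1)
  have hk (k : ℕ) : Complex.exp (2 * Real.pi * Complex.I * ((k : ℝ) : ℂ)) = 1 := by
    rw [Complex.exp_eq_one_iff]; exact ⟨k, by push_cast; ring⟩
  refine ⟨fun t ↦ x + ((c : ℂ) * (Complex.exp (2 * Real.pi * Complex.I * t) - 1)) • v, Λ,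
    by fun_prop, by simp, fun k ↦ ?_, hΛc, hΛ0, fun H t ↦ ?_, fun H k ↦ ?_⟩
  · simp only [hk]
    simp
  · rw [hΛe, map_add, map_smul, hav, smul_eq_mul]
    ring
  · rw [hΛk, hre]
    simp only [(hc H).2]

/-- Loops in the Milnor fiber, based at an arbitrary point, together with
continuous logarithms of the linear forms along them. -/
theorem exists_loops_milnorFiber [Nonempty A.hyperplanes]
    {f : A.hyperplanes → Module.Dual ℂ (Fin (d + 1) → ℂ)}
    (hf : A.IsDefiningFamily f) (m : A.hyperplanes → ℕ) (hm : ∀ H, 1 ≤ m H)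
    (x : A.milnorFiber f m) :
    ∃ w : A.hyperplanes → A.hyperplanes → ℤ, Submodule.span ℤ (Set.range w) = ⊤ ∧
      ∀ K, ∃ (γ : Path x x) (L : A.hyperplanes → C(unitInterval, ℂ)),
        (∀ H t, Complex.exp (L H t) = f H (γ t)) ∧
        ∀ H, L H 1 - L H 0 = 2 * Real.pi * Complex.I * (reducedWinding m (w K) H : ℂ) := by
  obtain ⟨x, hx, hxQ⟩ := x
  have hfx (H) : f H x ≠ 0 := fun h ↦ hx H H.2 (by rw [← hf H]; exact h)
  obtain ⟨w, hw, h⟩ := A.exists_loops_complement hf x hx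
  refine ⟨w, hw, fun K ↦ ?_⟩
  obtain ⟨γ, Λ, hγ, hγ0, hγk, hΛc, hΛ0, hΛe, hΛk⟩ := h K
  set N : ℕ := ∑ H, m H with hN
  have hN0 : N ≠ 0 := by
    obtain ⟨H⟩ := ‹Nonempty A.hyperplanes›
    have := Finset.single_le_sum (f := m) (fun _ _ ↦ Nat.zero_le _) (Finset.mem_univ H)
    have := hm H
    omega
  have hNC : (N : ℂ) ≠ 0 := Nat.cast_ne_zero.2 hN0
  -- `N s` is the logarithmic change of `Q_m` along the loop, so scaling by `exp(-s)` cancels it.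
  let s (t : ℝ) : ℂ := (∑ H, (m H : ℂ) * Λ H (N * t)) / N
  have hs : Continuous s := by fun_prop
  let δ (t : ℝ) : Fin (d + 1) → ℂ := Complex.exp (-s t) • γ (N * t)
  have hδ : Continuous δ := by fun_prop
  have hfδ (H t) : f H (δ t) = f H x * Complex.exp (Λ H (N * t) - s t) := by
    simp only [δ, map_smul, smul_eq_mul, hΛe, sub_eq_add_neg, Complex.exp_add]
    ring
  have hmem (t : ℝ) : δ t ∈ A.milnorFiber f m := by
    refine ⟨fun H hH hδH ↦ ?_, ?_⟩
    · have hδH : δ t ∈ ((⟨H, hH⟩ : A.hyperplanes) : Submodule ℂ (Fin (d + 1) → ℂ)) := hδH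
      rw [← hf, LinearMap.mem_ker, hfδ] at hδH
      exact mul_ne_zero (hfx _) (Complex.exp_ne_zero _) hδH
    · have : ∑ H, (m H : ℂ) * (Λ H (N * t) - s t) = 0 := by
        simp only [mul_sub, Finset.sum_sub_distrib]
        rw [← Finset.sum_mul, ← Nat.cast_sum, ← hN]
        simp only [s]
        field_simp
        ring
      rw [definingPolynomial] at hxQ ⊢
      simp only [hfδ, mul_pow, Finset.prod_mul_distrib, hxQ, ← Complex.exp_nat_mul]
      rw [← Complex.exp_sum, this, Complex.exp_zero, mul_one]
  have hs0 : s 0 = 0 := by simp [s, hΛ0]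
  have hΛN (H) : Λ H (N * (1 : ℝ)) = 2 * Real.pi * Complex.I * (N * (w K H : ℂ)) := by
    rw [mul_one, hΛk]
  have hs1 : s 1 = 2 * Real.pi * Complex.I * (∑ H, (m H : ℂ) * (w K H : ℂ)) := by
    simp only [s, hΛN]
    rw [div_eq_iff hNC, Finset.mul_sum, Finset.sum_mul]
    exact Finset.sum_congr rfl fun H _ ↦ by ring
  have hδ0 : δ 0 = x := by simp [δ, hs0, hγ0]
  -- The `N` turns cancel the division by `N`: `s 1` lies in `2πiℤ`, so the rescaled path closes up.
  have hδ1 : δ 1 = x := by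
    have : Complex.exp (-s 1) = 1 := by
      rw [Complex.exp_eq_one_iff]
      exact ⟨-∑ H, (m H : ℤ) * w K H, by rw [hs1]; push_cast; ring⟩
    simp [δ, this, hγk]
  refine ⟨⟨⟨fun t ↦ ⟨δ t, hmem t⟩, by fun_prop⟩, Subtype.ext hδ0, Subtype.ext hδ1⟩,
    fun H ↦ ⟨fun t ↦ Complex.log (f H x) + (Λ H (N * t) - s t), by fun_prop⟩,
    fun H t ↦ ?_, fun H ↦ ?_⟩
  · have := hfδ H t
    simp only [ContinuousMap.coe_mk]
    rw [Complex.exp_add, Complex.exp_log (hfx H), ← this]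
    rfl
  · simp only [ContinuousMap.coe_mk, Set.Icc.coe_one, Set.Icc.coe_zero]
    rw [hΛN, hs1, hs0, mul_zero, hΛ0, reducedWinding]
    simp only [LinearMap.coe_mk, AddHom.coe_mk]
    rw [hN]
    push_cast
    ring

/-- `Q_m` is homogeneous of degree `N > 0`, so a point off the hyperplanes can be rescaled by an
`N`-th root. -/
theorem nonempty_milnorFiber [Nonempty A.hyperplanes]
    {f : A.hyperplanes → Module.Dual ℂ (Fin (d + 1) → ℂ)}
    (hf : A.IsDefiningFamily f) (m : A.hyperplanes → ℕ) (hm : ∀ H, 1 ≤ m H) :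
    Nonempty (A.milnorFiber f m) := by
  have htop : ⊤ ∉ A.hyperplanes := fun h ↦ by
    have := A.codim_eq_one ⊤ h
    rw [Module.finrank_zero_of_subsingleton] at this
    exact zero_ne_one this
  obtain ⟨z, hz⟩ :=
    (Set.ne_univ_iff_exists_notMem _).1 (Subspace.biUnion_ne_univ_of_top_notMem htop)
  have hz (H) (hH : H ∈ A.hyperplanes) : z ∉ H := fun h ↦ hz (Set.mem_iUnion₂.2 ⟨H, hH, h⟩)
  have hfz (H) : f H z ≠ 0 := fun h ↦ hz H H.2 (by rw [← hf H]; exact h)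
  have hN0 : 0 < ∑ H, m H :=
    Finset.sum_pos (fun H _ ↦ hm H) Finset.univ_nonempty
  have hQ : A.definingPolynomial f m z ≠ 0 :=
    Finset.prod_ne_zero_iff.2 fun H _ ↦ pow_ne_zero _ (hfz H)
  obtain ⟨a, ha⟩ := IsAlgClosed.exists_pow_nat_eq (A.definingPolynomial f m z)⁻¹ hN0
  have ha0 : a ≠ 0 := by
    rintro rfl
    rw [zero_pow hN0.ne'] at ha
    exact inv_ne_zero hQ ha.symm
  refine ⟨⟨a • z, fun H hH h ↦ hz H hH ((H.smul_mem_iff ha0).1 h), ?_⟩⟩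
  simp only [definingPolynomial, map_smul, smul_eq_mul, mul_pow, Finset.prod_mul_distrib]
  rw [Finset.prod_pow_eq_pow_sum, ha]
  exact inv_mul_cancel₀ hQ

end HyperplaneArrangement

/-! ### Logarithmic cocycles and first homology. -/

open CategoryTheory Limits Simplicial in
/-- A `1`-cocycle on a simplicial set with values in an abelian group `M` induces a homomorphism
on first homology, whose value on the class of an edge with equal endpoints is
the value of the cocycle. -/
theorem SSet.exists_homology_one_hom (X : SSet.{0}) {M : Type} [AddCommGroup M] (w : X _⦋1⦌ → M)
    (hw : ∀ s : X _⦋2⦌, w (X.δ 1 s) = w (X.δ 0 s) + w (X.δ 2 s)) :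
    ∃ ψ : (X.homology (ModuleCat.of ℤ ℤ) 1 : ModuleCat.{0} ℤ) →ₗ[ℤ] M,
      ∀ x : X _⦋1⦌, X.δ 0 x = X.δ 1 x → ∃ h, ψ h = w x := by
  let R : ModuleCat.{0} ℤ := ModuleCat.of ℤ ℤ
  let e (a : M) : R ⟶ ModuleCat.of ℤ M := ModuleCat.ofHom (LinearMap.toSpanSingleton ℤ M a)
  have he (a b : M) : e (a + b) = e a + e b := by
    ext
    simp [e]
  let c : (X.chainComplex R).X 1 ⟶ ModuleCat.of ℤ M :=
    Cofan.IsColimit.desc (X.isColimitChainComplexXCofan R 1) fun x ↦ e (w x)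
  have hc (x : X _⦋1⦌) : X.ιChainComplex x ≫ c = e (w x) :=
    Cofan.IsColimit.fac (X.isColimitChainComplexXCofan R 1) _ x
  have hdc : (X.chainComplex R).d 2 1 ≫ c = 0 := by
    refine SSet.chainComplex_hom_ext fun s ↦ ?_
    rw [SSet.ιChainComplex_d_assoc, Preadditive.sum_comp, Fin.sum_univ_three]
    simp only [Preadditive.zsmul_comp, hc, hw, he]
    simp
  -- The cocycle kills boundaries, so it descends to `opcycles`, which contains the homology.
  refine ⟨((X.chainComplex R).homologyι 1 ≫
    (X.chainComplex R).descOpcycles c 2 (by simp) hdc).hom, fun x hx ↦ ?_⟩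
  have hxd : X.ιChainComplex x ≫ (X.chainComplex R).d 1 0 = 0 := by
    rw [SSet.ιChainComplex_d, Fin.sum_univ_two, hx]
    simp
  let z : R ⟶ (X.chainComplex R).homology 1 :=
    (X.chainComplex R).liftCycles (X.ιChainComplex x) 0 (by simp) hxd ≫
      (X.chainComplex R).homologyπ 1
  have hz : z ≫ ((X.chainComplex R).homologyι 1 ≫
      (X.chainComplex R).descOpcycles c 2 (by simp) hdc) = e (w x) := by
    simp only [z, Category.assoc, HomologicalComplex.homology_π_ι_assoc,
      HomologicalComplex.p_descOpcycles, HomologicalComplex.liftCycles_i_assoc, hc]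
  refine ⟨z.hom (1 : ℤ), ?_⟩
  have := congr($(hz).hom (1 : ℤ))
  exact this.trans (LinearMap.toSpanSingleton_apply_one _ _ _)

section Logarithm

variable {Y : Type*} [TopologicalSpace Y]

theorem exists_continuousMap_exp_eq [SimplyConnectedSpace Y] [LocallyPathConnectedSpace Y]
    (g : C(Y, ℂ)) (hg : ∀ y, g y ≠ 0) : ∃ L : C(Y, ℂ), ∀ y, Complex.exp (L y) = g y := by
  obtain ⟨y₀⟩ : Nonempty Y := inferInstance
  obtain ⟨L, ⟨-, hL⟩, -⟩ := Complex.isCoveringMap_exp.existsUnique_continuousMap_lifts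
    (⟨fun y ↦ ⟨g y, hg y⟩, by fun_prop⟩ : C(Y, {z : ℂ // z ≠ 0})) y₀ (Complex.log (g y₀))
    (Subtype.ext (Complex.exp_log (hg y₀)))
  exact ⟨L, fun y ↦ congr(($hL y).1)⟩

/-- Two logarithms of one function on a connected space differ by a constant, so increments do not
depend on the choice. -/
theorem sub_eq_sub_of_exp_eq [PreconnectedSpace Y] (L L' : C(Y, ℂ))
    (h : ∀ y, Complex.exp (L y) = Complex.exp (L' y)) (a b : Y) : L b - L a = L' b - L' a := by
  have hexp : Complex.exp (L a - L' a) = 1 := by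
    rw [Complex.exp_sub, h, div_self (Complex.exp_ne_zero _)]
  have := Complex.isCoveringMap_exp.eq_of_comp_eq (g₁ := fun y ↦ L y)
    (g₂ := fun y ↦ L' y + (L a - L' a)) (by fun_prop) (by fun_prop)
    (funext fun y ↦ Subtype.ext (by simp [Complex.exp_add, hexp, h])) a (by simp)
  have : L b = L' b + (L a - L' a) := congrFun this b
  rw [this]
  ring

open Classical in
/-- The increment from `a` to `b` of a continuous logarithm of `g`. -/
noncomputable def logIncrement (g : C(Y, ℂ)) (a b : Y) : ℂ :=
  if h : ∃ L : C(Y, ℂ), ∀ y, Complex.exp (L y) = g y then h.choose b - h.choose a else 0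

theorem logIncrement_eq [PreconnectedSpace Y] {g : C(Y, ℂ)} (L : C(Y, ℂ))
    (hL : ∀ y, Complex.exp (L y) = g y) (a b : Y) : logIncrement g a b = L b - L a := by
  have h : ∃ L : C(Y, ℂ), ∀ y, Complex.exp (L y) = g y := ⟨L, hL⟩
  rw [logIncrement, dif_pos h]
  exact sub_eq_sub_of_exp_eq _ _ (fun y ↦ (h.choose_spec y).trans (hL y).symm) a b

end Logarithm

instance (n : ℕ) : SimplyConnectedSpace (stdSimplex ℝ (Fin (n + 1))) :=
  have := (convex_stdSimplex ℝ (Fin (n + 1))).contractibleSpace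
    (Set.nonempty_coe_sort.1 inferInstance)
  inferInstance

instance (n : ℕ) : LocallyPathConnectedSpace (stdSimplex ℝ (Fin (n + 1))) :=
  (convex_stdSimplex ℝ (Fin (n + 1))).locallyPathConnectedSpace

section SingularSimplex

open Simplicial

/-- The singular `n`-simplex of `X` underlying a simplex of the singular simplicial set. -/
noncomputable def singularSimplexMap (X : Type) [TopologicalSpace X] (n : ℕ)
    (s : (TopCat.toSSet.obj (TopCat.of X)) _⦋n⦌) : C(stdSimplex ℝ (Fin (n + 1)), X) :=
  (TopCat.of X).toSSetObjEquiv _ s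

theorem singularSimplexMap_δ {X : Type} [TopologicalSpace X] {n : ℕ}
    (s : (TopCat.toSSet.obj (TopCat.of X)) _⦋n + 1⦌) (i : Fin (n + 2))
    (y : stdSimplex ℝ (Fin (n + 1))) :
    singularSimplexMap X n ((TopCat.toSSet.obj (TopCat.of X)).δ i s) y =
      singularSimplexMap X (n + 1) s (stdSimplex.map i.succAbove y) :=
  TopCat.toSSetObjEquiv_δ_apply _ _ _

theorem singularSimplexMap_bijective (X : Type) [TopologicalSpace X] (n : ℕ) :
    Function.Bijective (singularSimplexMap X n) :=
  ((TopCat.of X).toSSetObjEquiv _).bijective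

/-- The increment of a continuous logarithm of `g` along a singular `1`-simplex. -/
noncomputable def logCochain {X : Type} [TopologicalSpace X] (g : C(X, ℂ))
    (s : (TopCat.toSSet.obj (TopCat.of X)) _⦋1⦌) : ℂ :=
  logIncrement (g.comp (singularSimplexMap X 1 s)) (stdSimplex.vertex 0) (stdSimplex.vertex 1)

/-- One logarithm on the triangle restricts to all three edges, and its increments telescope. -/
theorem logCochain_cocycle {X : Type} [TopologicalSpace X] (g : C(X, ℂ)) (hg : ∀ x, g x ≠ 0)
    (s : (TopCat.toSSet.obj (TopCat.of X)) _⦋2⦌) :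
    logCochain g ((TopCat.toSSet.obj (TopCat.of X)).δ 1 s) =
      logCochain g ((TopCat.toSSet.obj (TopCat.of X)).δ 0 s) +
        logCochain g ((TopCat.toSSet.obj (TopCat.of X)).δ 2 s) := by
  obtain ⟨L, hL⟩ := exists_continuousMap_exp_eq (g.comp (singularSimplexMap X 2 s)) fun y ↦ hg _
  have hface (k : Fin 3) : logCochain g ((TopCat.toSSet.obj (TopCat.of X)).δ k s) =
      L (stdSimplex.vertex (k.succAbove 1)) - L (stdSimplex.vertex (k.succAbove 0)) := by
    rw [logCochain, logIncrement_eq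
      (L.comp ⟨stdSimplex.map k.succAbove, stdSimplex.continuous_map _⟩)
      (fun y ↦ by
        rw [ContinuousMap.comp_apply, ContinuousMap.comp_apply, singularSimplexMap_δ]
        exact hL _)]
    simp only [ContinuousMap.comp_apply, ContinuousMap.coe_mk, stdSimplex.map_vertex]
  rw [hface, hface, hface,
    show (1 : Fin 3).succAbove (1 : Fin 2) = 2 from rfl,
    show (1 : Fin 3).succAbove (0 : Fin 2) = 0 from rfl,
    show (0 : Fin 3).succAbove (1 : Fin 2) = 2 from rfl,
    show (0 : Fin 3).succAbove (0 : Fin 2) = 1 from rfl,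
    show (2 : Fin 3).succAbove (1 : Fin 2) = 1 from rfl,
    show (2 : Fin 3).succAbove (0 : Fin 2) = 0 from rfl]
  ring

/-- A loop, viewed as a singular `1`-simplex, has equal endpoints, and continuous logarithms along
the loop compute the values of the cochains `logCochain`. -/
theorem exists_singularSimplex_of_loop {X : Type} [TopologicalSpace X] {x : X} (γ : Path x x) :
    ∃ s : (TopCat.toSSet.obj (TopCat.of X)) _⦋1⦌,
      (TopCat.toSSet.obj (TopCat.of X)).δ 0 s = (TopCat.toSSet.obj (TopCat.of X)).δ 1 s ∧
      ∀ (g : C(X, ℂ)) (L : C(unitInterval, ℂ)), (∀ t, Complex.exp (L t) = g (γ t)) →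
        logCochain g s = L 1 - L 0 := by
  obtain ⟨s, hs⟩ := (singularSimplexMap_bijective X 1).2
    (γ.toContinuousMap.comp (stdSimplexHomeomorphUnitInterval : C(_, unitInterval)))
  refine ⟨s, (singularSimplexMap_bijective X 0).1 (ContinuousMap.ext fun y ↦ ?_),
    fun g L hL ↦ ?_⟩
  · rw [singularSimplexMap_δ, singularSimplexMap_δ, hs]
    obtain rfl : y = stdSimplex.vertex (S := ℝ) (0 : Fin 1) := Subsingleton.elim _ _
    rw [stdSimplex.map_vertex, stdSimplex.map_vertex]
    simp
  · rw [logCochain, hs,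
      logIncrement_eq (L.comp (stdSimplexHomeomorphUnitInterval : C(_, unitInterval)))
        (fun y ↦ hL _)]
    simp

theorem exists_firstHomology_hom {X : Type} [TopologicalSpace X] {ι : Type} (g : ι → C(X, ℂ))
    (hg : ∀ i x, g i x ≠ 0) :
    ∃ ψ : firstHomology X →ₗ[ℤ] (ι → ℂ), ∀ (x : X) (γ : Path x x) (L : ι → C(unitInterval, ℂ)),
      (∀ i t, Complex.exp (L i t) = g i (γ t)) → ∃ h, ψ h = fun i ↦ L i 1 - L i 0 := by
  obtain ⟨ψ, hψ⟩ := (TopCat.toSSet.obj (TopCat.of X)).exists_homology_one_hom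
    (fun s i ↦ logCochain (g i) s) fun s ↦ funext fun i ↦ logCochain_cocycle (g i) (hg i) s
  refine ⟨ψ, fun x γ L hL ↦ ?_⟩
  obtain ⟨s, hs, hsL⟩ := exists_singularSimplex_of_loop γ
  obtain ⟨h, hh⟩ := hψ s hs
  exact ⟨h, hh.trans (funext fun i ↦ hsL _ _ (hL i))⟩

end SingularSimplex

/-! ### Logarithm increments on the fundamental group. -/

/-- A continuous nowhere vanishing function `g` on `X` induces a homomorphism from the fundamental
group of `X` to `2πiℤ`, sending the class of a loop to the increment along the loop
of a continuous logarithm of `g`. -/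
theorem exists_fundamentalGroup_hom {X : Type} [TopologicalSpace X] (g : C(X, ℂ))
    (hg : ∀ x, g x ≠ 0) (x : X) :
    ∃ φ : FundamentalGroup X x →*
        Multiplicative (AddSubgroup.zmultiples (2 * Real.pi * Complex.I)),
      ∀ (γ : Path x x) (L : C(unitInterval, ℂ)), (∀ t, Complex.exp (L t) = g (γ t)) →
        ((φ (FundamentalGroup.fromPath (Path.Homotopic.Quotient.mk γ))).toAdd : ℂ) =
          L 1 - L 0 := by
  let g' : C(X, {z : ℂ // z ≠ 0}) := ⟨fun y ↦ ⟨g y, hg y⟩, by fun_prop⟩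
  let p : ℂ → {z : ℂ // z ≠ 0} := fun z ↦ ⟨_, z.exp_ne_zero⟩
  have hp : IsAddQuotientCoveringMap p (AddSubgroup.zmultiples (2 * Real.pi * Complex.I)) :=
    Complex.isAddQuotientCoveringMap_exp
  let e : p ⁻¹' {g' x} := ⟨Complex.log (g x), Subtype.ext (Complex.exp_log (hg x))⟩
  -- The deck group is commutative, so passing to the opposite group is harmless.
  refine ⟨(MulOpposite.opMulEquiv.symm.toMonoidHom.comp
    (hp.fundamentalGroupToMulOpposite e)).comp (FundamentalGroup.map g' x), fun γ L hL ↦ ?_⟩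
  have h := hp.unop_fundamentalGroupToMulOpposite_smul (e := e)
    (γ := FundamentalGroup.fromPath (Path.Homotopic.Quotient.mk (γ.map g'.continuous)))
  have hmon : (hp.isCoveringMap.monodromy
      (Path.Homotopic.Quotient.mk (γ.map g'.continuous)) e : ℂ) = L 1 - L 0 + e.1 := by
    have hlift := (hp.isCoveringMap.eq_liftPath_iff'
      (γ := (γ.map g'.continuous).toContinuousMap) (e := e.1)
      (γ_0 := (γ.map g'.continuous).source.trans e.2.symm)
      (Γ := ⟨fun t ↦ L t - L 0 + e.1, by fun_prop⟩)).2
      ⟨funext fun t ↦ Subtype.ext ?_, by simp⟩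
    · exact congr($(hlift) 1).symm
    · have h0 := hL 0
      have h1 := hL t
      rw [γ.source] at h0
      simp [p, e, g', Complex.exp_add, Complex.exp_sub, h0, h1, Complex.exp_log (hg x), hg x]
  exact add_right_cancel (h.trans hmon)

/-! ### Rank count and surjections onto free abelian groups. -/

/-- Vectors in the kernel are constant, hence determined by one coordinate. -/
theorem finrank_ker_reducedWinding_le_one {ι : Type*} [Fintype ι] (m : ι → ℕ) (hm : ∑ i, m i ≠ 0) :
    Module.finrank ℤ (LinearMap.ker (reducedWinding m)) ≤ 1 := by
  have hN : (∑ i, (m i : ℤ)) ≠ 0 := by exact_mod_cast hm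
  obtain ⟨i₀⟩ : Nonempty ι := by
    by_contra h
    rw [not_nonempty_iff] at h
    exact hm (by simp)
  have hinj : Function.Injective
      ((LinearMap.proj i₀ : (ι → ℤ) →ₗ[ℤ] ℤ) ∘ₗ (LinearMap.ker (reducedWinding m)).subtype) := by
    rw [← LinearMap.ker_eq_bot, LinearMap.ker_eq_bot']
    rintro ⟨w, hw⟩ hw0
    have hw0 : w i₀ = 0 := hw0
    have hwi (i : ι) : (∑ j, (m j : ℤ)) * w i = ∑ j, (m j : ℤ) * w j :=
      sub_eq_zero.1 (congrFun (LinearMap.mem_ker.1 hw) i)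
    refine Subtype.ext (funext fun i ↦ mul_left_cancel₀ hN ?_)
    rw [hwi, ← hwi i₀, hw0]
    simp
  exact (LinearMap.finrank_le_finrank_of_injective hinj).trans_eq (Module.finrank_self ℤ)

theorem card_sub_one_le_rank_range_reducedWinding {ι : Type} [Fintype ι] (m : ι → ℕ)
    (hm : ∑ i, m i ≠ 0) :
    ((Fintype.card ι - 1 : ℕ) : Cardinal) ≤
      Module.rank ℤ (LinearMap.range (reducedWinding m)) := by
  have h := LinearMap.rank_range_add_rank_ker (reducedWinding m)
  rw [← Module.finrank_eq_rank, ← Module.finrank_eq_rank, ← Module.finrank_eq_rank,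
    Module.finrank_fintype_fun_eq_card] at h
  have h' : Module.finrank ℤ (LinearMap.range (reducedWinding m)) +
    Module.finrank ℤ (LinearMap.ker (reducedWinding m)) = Fintype.card ι := by exact_mod_cast h
  have := finrank_ker_reducedWinding_le_one m hm
  rw [← Module.finrank_eq_rank]
  exact_mod_cast (by omega : Fintype.card ι - 1 ≤ _)

theorem card_sub_one_le_rank_of_reducedWinding_mem {ι : Type} [Fintype ι] (m : ι → ℕ)
    (hm : ∑ i, m i ≠ 0) (w : ι → ι → ℤ) (hw : Submodule.span ℤ (Set.range w) = ⊤)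
    (S : Submodule ℤ (ι → ℂ))
    (hS : ∀ k, (fun i ↦ 2 * Real.pi * Complex.I * (reducedWinding m (w k) i : ℂ)) ∈ S) :
    ((Fintype.card ι - 1 : ℕ) : Cardinal) ≤ Module.rank ℤ S := by
  let j : (ι → ℤ) →ₗ[ℤ] (ι → ℂ) := LinearMap.pi fun i ↦
    LinearMap.toSpanSingleton ℤ ℂ (2 * Real.pi * Complex.I) ∘ₗ LinearMap.proj i
  have hj (v : ι → ℤ) (i : ι) : j v i = 2 * Real.pi * Complex.I * (v i : ℂ) := by
    simp [j, mul_comm]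
  have hinj : Function.Injective j := by
    intro v v' h
    ext i
    have := congrFun h i
    rw [hj, hj] at this
    exact_mod_cast mul_left_cancel₀ Complex.two_pi_I_ne_zero this
  refine (card_sub_one_le_rank_range_reducedWinding m hm).trans ?_
  rw [← rank_map_eq hinj]
  refine Submodule.rank_mono ?_
  rw [LinearMap.range_eq_map, ← hw, Submodule.map_span, Submodule.map_span, Submodule.span_le]
  rintro _ ⟨_, ⟨_, ⟨k, rfl⟩, rfl⟩, rfl⟩
  rw [SetLike.mem_coe, funext (hj (reducedWinding m (w k)))]
  exact hS k

/-- A group with a homomorphism to a finitely generated free abelian group whose image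
has rank at least `k` surjects onto `ℤ^k`. -/
theorem exists_surjective_of_le_rank_range {G M : Type} [Group G] [AddCommGroup M]
    [Module.Finite ℤ M] [Module.Free ℤ M] (φ : G →* Multiplicative M) (k : ℕ)
    (S : Submodule ℤ M) (hS : ∀ a, a ∈ S ↔ ∃ g, (φ g).toAdd = a)
    (hk : (k : Cardinal) ≤ Module.rank ℤ S) :
    ∃ ψ : G →* Multiplicative (Fin k → ℤ), Function.Surjective ψ := by
  rw [← Module.finrank_eq_rank] at hk
  have hk : k ≤ Module.finrank ℤ S := by exact_mod_cast hk
  -- A subgroup of a finitely generated free abelian group is free; `T` keeps its first `k`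
  -- coordinates.
  let b := Module.finBasis ℤ S
  let T : S →ₗ[ℤ] (Fin k → ℤ) :=
    LinearMap.funLeft ℤ ℤ (Fin.castLE hk) ∘ₗ b.equivFun.toLinearMap
  have hT : Function.Surjective T :=
    (LinearMap.funLeft_surjective_of_injective ℤ ℤ _ (Fin.castLE_injective hk)).comp
      b.equivFun.surjective
  let φ' : G →* Multiplicative S :=
    { toFun g := Multiplicative.ofAdd ⟨(φ g).toAdd, (hS _).2 ⟨g, rfl⟩⟩
      map_one' := by
        simp only [map_one, toAdd_one]
        rfl
      map_mul' g h := by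
        simp only [map_mul, toAdd_mul]
        rfl }
  refine ⟨(AddMonoidHom.toMultiplicative T.toAddMonoidHom).comp φ', fun a ↦ ?_⟩
  obtain ⟨⟨s, hs⟩, hsa⟩ := hT a.toAdd
  obtain ⟨g, rfl⟩ := (hS _).1 hs
  exact ⟨g, hsa⟩

/-- The bound is asked of any submodule containing the increments, so one estimate serves both `π_1`
and `H_1`. Replacing `ℂ` by `2πiℤ` makes the target finitely generated and free. -/
theorem exists_fundamentalGroup_surjective {X : Type} [TopologicalSpace X] {ι : Type} [Fintype ι]
    (g : ι → C(X, ℂ)) (hg : ∀ i x, g i x ≠ 0) (x : X) (k : ℕ)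
    (hk : ∀ S : Submodule ℤ (ι → ℂ), (∀ (γ : Path x x) (L : ι → C(unitInterval, ℂ)),
      (∀ i t, Complex.exp (L i t) = g i (γ t)) → (fun i ↦ L i 1 - L i 0) ∈ S) →
        (k : Cardinal) ≤ Module.rank ℤ S) :
    ∃ ψ : FundamentalGroup X x →* Multiplicative (Fin k → ℤ), Function.Surjective ψ := by
  let Z := AddSubgroup.zmultiples (2 * Real.pi * Complex.I)
  choose φ hφ using fun i ↦ exists_fundamentalGroup_hom (g i) (hg i) x
  have : Module.Finite ℤ Z := Module.Finite.of_surjective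
    (LinearMap.toSpanSingleton ℤ Z ⟨_, AddSubgroup.mem_zmultiples _⟩) (by
      rintro ⟨_, k, rfl⟩
      exact ⟨k, rfl⟩)
  have : Module.Free ℤ Z := Module.free_of_finite_type_torsion_free'
  let Φ : FundamentalGroup X x →* Multiplicative (ι → Z) :=
    { toFun a := Multiplicative.ofAdd fun i ↦ (φ i a).toAdd
      map_one' := by
        simp only [map_one, toAdd_one]
        rfl
      map_mul' a b := by
        simp only [map_mul, toAdd_mul]
        rfl }
  let S : Submodule ℤ (ι → Z) := AddSubgroup.toIntSubmodule (MonoidHom.toAdditiveLeft Φ).range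
  let j : (ι → Z) →ₗ[ℤ] (ι → ℂ) := LinearMap.pi fun i ↦
    Z.subtype.toIntLinearMap ∘ₗ LinearMap.proj i
  have hj : Function.Injective j := fun a b h ↦ funext fun i ↦ Subtype.ext (congrFun h i)
  refine exists_surjective_of_le_rank_range Φ k S (fun a ↦ Iff.rfl) ?_
  rw [← rank_map_eq hj]
  refine hk _ fun γ L hL ↦ ?_
  exact ⟨(Φ (FundamentalGroup.fromPath (Path.Homotopic.Quotient.mk γ))).toAdd, ⟨_, rfl⟩,
    funext fun i ↦ hφ i γ (L i) (hL i)⟩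

theorem corollary4p5 (d : ℕ) (A : HyperplaneArrangement d)
    (f : A.hyperplanes → Module.Dual ℂ (Fin (d + 1) → ℂ)) (hf : A.IsDefiningFamily f)
    (m : A.hyperplanes → ℕ) (hm : ∀ H, 1 ≤ m H) (hgcd : Finset.univ.gcd m = 1) :
    ((A.hyperplanes.card - 1 : ℕ) : ℕ∞) ≤ firstBettiNumber (A.milnorFiber f m) ∧
    ∀ x : A.milnorFiber f m,
      ∃ φ : FundamentalGroup (A.milnorFiber f m) x →*
          Multiplicative (Fin (A.hyperplanes.card - 1) → ℤ),
        Function.Surjective φ := by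
  have hne : Nonempty A.hyperplanes := by
    by_contra h
    rw [not_nonempty_iff] at h
    simp at hgcd
  have hN : ∑ H, m H ≠ 0 := (Finset.sum_pos (fun H _ ↦ hm H) Finset.univ_nonempty).ne'
  let g (H : A.hyperplanes) : C(A.milnorFiber f m, ℂ) :=
    ⟨fun z ↦ f H z, (f H).continuous_of_finiteDimensional.comp continuous_subtype_val⟩
  have hg (H) (z) : g H z ≠ 0 := fun h ↦
    z.2.1 H H.2 (by rw [← hf H]; exact h)
  have key (x : A.milnorFiber f m) (S : Submodule ℤ (A.hyperplanes → ℂ))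
      (hS : ∀ (γ : Path x x) (L : A.hyperplanes → C(unitInterval, ℂ)),
        (∀ i t, Complex.exp (L i t) = g i (γ t)) → (fun i ↦ L i 1 - L i 0) ∈ S) :
      ((A.hyperplanes.card - 1 : ℕ) : Cardinal) ≤ Module.rank ℤ S := by
    obtain ⟨w, hw, h⟩ := A.exists_loops_milnorFiber hf m hm x
    rw [← Fintype.card_coe]
    refine card_sub_one_le_rank_of_reducedWinding_mem m hN w hw S fun K ↦ ?_
    obtain ⟨γ, L, hL, hinc⟩ := h K
    have := hS γ L hL
    simpa only [hinc] using this
  refine ⟨?_, fun x ↦ exists_fundamentalGroup_surjective g hg x _ (key x)⟩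
  obtain ⟨x⟩ := A.nonempty_milnorFiber hf m hm
  obtain ⟨ψ, hψ⟩ := exists_firstHomology_hom g hg
  have hrank := (key x (LinearMap.range ψ) fun γ L hL ↦ hψ x γ L hL).trans
    (rank_range_le ψ)
  simpa [firstBettiNumber] using Cardinal.toENat.monotone' hrank
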